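/- Let $G$ be a finite 3-regular multigraph (parallel edges and loops allowed; a loop counts twice towards the degree of its vertex) with vertex set $V$, and fix a plane drawing of $G$, i.e. a drawing in the plane in which the edges are polygonal arcs that are simple (simple closed curves for loops) and meet each other and the vertices only at their ends. Let $K$ be the number of proper 3-edge-colorings of $G$, i.e. of maps from the edges to $\{0,1,2\}$ such that any two distinct half-edges at the same vertex receive distinct colors (so $K=0$ if $G$ has a loop). Let $\epsilon$ be the order-3 Levi-Civita tensor: $\epsilon_{012}=\epsilon_{120}=\epsilon_{201}=1$, $\epsilon_{021}=\epsilon_{210}=\epsilon_{102}=-1$, and all other components are $0$. Put a copy of $\epsilon$ at each vertex, with its three legs attached to the three half-edges there in some order, put a wire (the identity tensor $\delta_{ij}$) on each edge, and let $T$ be the full contraction of the resulting network, i.e. the sum, over all assignments of index values in $\{0,1,2\}$ to the half-edges, of the product of the corresponding components of all the tensors and wires. Then $|V|$ is even. At every vertex the chosen order of the legs follows either the counterclockwise or the clockwise cyclic order of the half-edges in the drawing, and not both; the legs can be ordered counterclockwise at all vertices simultaneously. Let $m$ be the number of vertices at which the order is clockwise. Then every proper 3-edge-coloring contributes the same term $(-1)^{|V|/2+m}$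 to the contraction, and $$T=(-1)^{|V|/2+m}\,K .$$ In particular $T=K$ whenever $|V|/2+m$ is even, and leg orders with this property exist. -/

import Mathlib

open scoped BigOperators

/-- A multigraph on the vertex type `V` with edge type `E`; loops and parallel edges are allowed.
Each edge has two ends, labelled by `false` and `true` (the labelling is only a way of naming
the ends, edges are not directed). -/
structure Multigraph (V E : Type*) where
  /-- the vertex at which the given end of the given edge sits -/
  ends : E → Bool → V

namespace Multigraph

variable {V E : Type*}

/-- The half-edges at the vertex `v`; a loop at `v` contributes two of them. -/
abbrev HalfEdgeAt (G : Multigraph V E) (v : V) : Type _ :=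
  {h : E × Bool // G.ends h.1 h.2 = v}

/-- `G` is 3-regular. -/
def IsCubic (G : Multigraph V E) : Prop :=
  ∀ v, Nat.card (G.HalfEdgeAt v) = 3

/-- `c` is a proper 3-edge-coloring: distinct half-edges at a common vertex have distinct colors.
(So a graph with a loop has no proper coloring.) -/
def IsProper (G : Multigraph V E) (c : E → Fin 3) : Prop :=
  ∀ v, ∀ h h' : G.HalfEdgeAt v, h ≠ h' → c h.1.1 ≠ c h'.1.1

/-- The number of proper 3-edge-colorings. -/
noncomputable def numColorings (G : Multigraph V E) : ℕ :=
  Nat.card {c : E → Fin 3 // G.IsProper c}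

/-! ### The tensor network -/

/-- The order-3 epsilon tensor. -/
def epsilon : Fin 3 → Fin 3 → Fin 3 → ℤ
  | 0, 1, 2 => 1
  | 1, 2, 0 => 1
  | 2, 0, 1 => 1
  | 0, 2, 1 => -1
  | 2, 1, 0 => -1
  | 1, 0, 2 => -1
  | _, _, _ => 0

/-- The wire, i.e. the identity tensor. -/
def wire (i j : Fin 3) : ℤ := if i = j then 1 else 0

/-- A choice, at every vertex, of which half-edge is attached to the first, second and third leg
of the tensor sitting there. -/
abbrev LegOrder (G : Multigraph V E) : Type _ :=
  ∀ v, Fin 3 ≃ G.HalfEdgeAt v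

/-- The term of the contraction that belongs to the assignment `i` of index values to the
half-edges: the product of the components of all epsilon tensors and all wires. -/
def weight [Fintype V] [Fintype E] {G : Multigraph V E} (l : G.LegOrder)
    (i : E × Bool → Fin 3) : ℤ :=
  (∏ v, epsilon (i (l v 0).1) (i (l v 1).1) (i (l v 2).1)) *
    ∏ e, wire (i (e, false)) (i (e, true))

/-- The full contraction of the network with an epsilon tensor at every vertex and a wire on
every edge. -/
def contraction [Fintype V] [Fintype E] [DecidableEq E] {G : Multigraph V E}
    (l : G.LegOrder) : ℤ :=
  ∑ i : E × Bool → Fin 3, weight l i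

/-! ### Plane drawings -/

/-- A drawing by polygonal arcs in the plane `ℂ`: the edge `e` is drawn as the polygonal line
from its `false` end through its corners, in order, to its `true` end. -/
structure Drawing (G : Multigraph V E) where
  /-- position of the vertices -/
  pos : V → ℂ
  /-- number of corners in the interior of an edge -/
  bends : E → ℕ
  /-- position of the corners -/
  corner : (e : E) → Fin (bends e) → ℂ

namespace Drawing

variable {G : Multigraph V E}

/-- The successive points of the polygonal line of `e`, both end points included. -/
def pt (D : G.Drawing) (e : E) : Fin (D.bends e + 2) → ℂ :=
  Fin.cons (α := fun _ => ℂ) (D.pos (G.ends e false))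
    (Fin.snoc (α := fun _ => ℂ) (D.corner e) (D.pos (G.ends e true)))

/-- The vertices and corners of the drawing. -/
def node (D : G.Drawing) : V ⊕ (Σ e, Fin (D.bends e)) → ℂ :=
  Sum.elim D.pos (fun x => D.corner x.1 x.2)

/-- The segments of which the edges consist, without their end points. -/
def seg (D : G.Drawing) (s : Σ e, Fin (D.bends e + 1)) : Set ℂ :=
  openSegment ℝ (D.pt s.1 s.2.castSucc) (D.pt s.1 s.2.succ)

/-- The drawing has no crossings: vertices and corners are pairwise distinct points, distinct open
segments are disjoint, and no vertex or corner lies on an open segment. Equivalently, every edge is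
drawn as a simple arc (a simple closed curve for a loop), and edges meet each other and the vertices
only at their ends. -/
structure IsPlane (D : G.Drawing) : Prop where
  node_injective : Function.Injective D.node
  seg_disjoint : Pairwise fun s t => Disjoint (D.seg s) (D.seg t)
  node_notMem : ∀ x s, D.node x ∉ D.seg s

/-- The direction in which a half-edge leaves its vertex. -/
def dir (D : G.Drawing) : E × Bool → ℂ
  | (e, false) => D.pt e (Fin.succ 0) - D.pt e 0
  | (e, true) => D.pt e (Fin.castSucc (Fin.last _)) - D.pt e (Fin.last _)

end Drawing

/-- Turning counterclockwise once around the origin, starting at the ray of `a`, one meets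
the ray of `b` and then the ray of `c`. -/
def Counterclockwise (a b c : ℂ) : Prop :=
  ∃ r s t α β γ : ℝ, 0 < r ∧ 0 < s ∧ 0 < t ∧
    a = r * Complex.exp (α * Complex.I) ∧
    b = s * Complex.exp (β * Complex.I) ∧
    c = t * Complex.exp (γ * Complex.I) ∧
    α < β ∧ β < γ ∧ γ < α + 2 * Real.pi

namespace Drawing

variable {G : Multigraph V E}

/-- The legs at `v` follow the counterclockwise cyclic order of the drawing. -/
def IsCCW (D : G.Drawing) (l : G.LegOrder) (v : V) : Prop :=
  Counterclockwise (D.dir (l v 0).1) (D.dir (l v 1).1) (D.dir (l v 2).1)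

/-- The legs at `v` follow the clockwise cyclic order of the drawing. -/
def IsCW (D : G.Drawing) (l : G.LegOrder) (v : V) : Prop :=
  Counterclockwise (D.dir (l v 2).1) (D.dir (l v 1).1) (D.dir (l v 0).1)

/-- The number of vertices whose legs are in clockwise order. -/
noncomputable def numCW (D : G.Drawing) (l : G.LegOrder) : ℕ :=
  Set.ncard {v | D.IsCW l v}

end Drawing

end Multigraph

/-! A nonzero term of the contraction has equal indices on the two halves of each edge and distinct
indices at each vertex, so it is a proper coloring. Its sign compares the given leg order with the
order by color, so everything reduces to `IsPlane.numCW_color_order`: when the legs are ordered by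
color, the number of clockwise vertices has the parity of |V|/2.

This parity is a mod 2 intersection argument. The edges of colors 0, 1 and those of colors 0, 2 form
two mod 2 cycles. For segments s and t, `crossing` is a sum of terms in which one segment is fixed
and the end points of the other enter separately; summed over a cycle, such terms cancel at every
node. So the total crossing number of the two cycles is 0, without any appeal to the Jordan curve
theorem. In a plane drawing only segments with a common end can have nonzero crossing number, and
there it equals a local `contact` term; hence the contacts sum to 0 (`sum_contact_eq_zero`).

Contacts at corners matter only on edges of color 0, common to both cycles. They telescope along
each such edge to 1 plus the sides to which its two ends leave (`IsPlane.sum_corners`). The 1's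
count the |V|/2 edges of color 0; the sides, joined to the contacts at a vertex, give 1 exactly at
clockwise vertices (`IsPlane.contact_vertex`). A generic shear makes all abscissae distinct
beforehand. -/

namespace PlaneParity

/-! ### Crossing parity of two segments -/

/-- The ordinate at abscissa `x` of the line through `p` and `q`. -/
noncomputable def height (p q : ℝ × ℝ) (x : ℝ) : ℝ :=
  p.2 + (x - p.1) * ((q.2 - p.2) / (q.1 - p.1))

open Classical in
/-- The parity of the event that `r` lies strictly below the open segment from `p` to `q`. -/
noncomputable def below (p q r : ℝ × ℝ) : ZMod 2 :=
  if (r.1 - p.1) * (r.1 - q.1) < 0 ∧ r.2 < height p q r.1 then 1 else 0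

open Classical in
/-- The parity of the event that `r` lies strictly above the open segment from `p` to `q`. -/
noncomputable def above (p q r : ℝ × ℝ) : ZMod 2 :=
  if (r.1 - p.1) * (r.1 - q.1) < 0 ∧ height p q r.1 < r.2 then 1 else 0

/-- The parity of the number of crossings of the segments `p q` and `r s`, expressed by the
relative position of end points; the expression also makes sense if the segments share ends. -/
noncomputable def crossing (p q r s : ℝ × ℝ) : ZMod 2 :=
  (below p q r + below p q s) + (above r s p + above r s q)

open Classical in
/-- The contribution to `crossing` of a common end point of two segments leaving it in the
directions `a` and `b`. -/
noncomputable def contact (a b : ℝ × ℝ) : ZMod 2 :=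
  if 0 < a.1 * b.1 ∧ 0 < a.1 * (b.1 * a.2 - b.2 * a.1) then 1 else 0

open Classical in
/-- The parity of the event that `a` points to the right. -/
noncomputable def rightward (a : ℝ × ℝ) : ZMod 2 := if 0 < a.1 then 1 else 0

lemma height_comm {p q : ℝ × ℝ} (h : p.1 ≠ q.1) (x : ℝ) : height p q x = height q p x := by
  have h1 : q.1 - p.1 ≠ 0 := sub_ne_zero.mpr h.symm
  have h2 : p.1 - q.1 ≠ 0 := sub_ne_zero.mpr h
  unfold height
  field_simp
  ring

lemma height_left (p q : ℝ × ℝ) : height p q p.1 = p.2 := by simp [height]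

lemma height_right {p q : ℝ × ℝ} (h : p.1 ≠ q.1) : height p q q.1 = q.2 := by
  rw [height_comm h, height_left]

lemma below_comm {p q : ℝ × ℝ} (h : p.1 ≠ q.1) (r : ℝ × ℝ) : below p q r = below q p r := by
  simp only [below, height_comm h, mul_comm]

lemma above_comm {p q : ℝ × ℝ} (h : p.1 ≠ q.1) (r : ℝ × ℝ) : above p q r = above q p r := by
  simp only [above, height_comm h, mul_comm]

lemma crossing_swap_left {p q : ℝ × ℝ} (h : p.1 ≠ q.1) (r s : ℝ × ℝ) :
    crossing p q r s = crossing q p r s := by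
  simp only [crossing, below_comm h, add_comm]

lemma crossing_swap_right {r s : ℝ × ℝ} (h : r.1 ≠ s.1) (p q : ℝ × ℝ) :
    crossing p q r s = crossing p q s r := by
  simp only [crossing, above_comm h, add_comm]

lemma height_mem_openSegment {p q : ℝ × ℝ} {x : ℝ} (h : (x - p.1) * (x - q.1) < 0) :
    (x, height p q x) ∈ openSegment ℝ p q := by
  have hpq : q.1 - p.1 ≠ 0 := by
    intro h0
    have : q.1 = p.1 := by linarith
    rw [this] at h
    nlinarith [mul_self_nonneg (x - p.1)]
  refine ⟨(q.1 - x) / (q.1 - p.1), (x - p.1) / (q.1 - p.1), ?_, ?_, ?_, ?_⟩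
  · rcases lt_or_gt_of_ne hpq with h1 | h1
    · apply div_pos_of_neg_of_neg _ h1
      by_contra h2
      nlinarith
    · apply div_pos _ h1
      by_contra h2
      nlinarith
  · rcases lt_or_gt_of_ne hpq with h1 | h1
    · apply div_pos_of_neg_of_neg _ h1
      by_contra h2
      nlinarith
    · apply div_pos _ h1
      by_contra h2
      nlinarith
  · field_simp
    ring
  · ext
    · simp
      field_simp
      ring
    · simp [height]
      field_simp
      ring

/-- Two lines that change their relative height between `x` and `y` meet in between. -/
lemma exists_height_eq {p q r s : ℝ × ℝ} {x y : ℝ} (hxy : x < y)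
    (hx : height r s x < height p q x) (hy : height p q y < height r s y) :
    ∃ z, x < z ∧ z < y ∧ height p q z = height r s z := by
  set f : ℝ → ℝ := fun z => height p q z - height r s z with hf
  have hc : ContinuousOn f (Set.Icc x y) := by
    simp only [hf, height]
    fun_prop
  have h0 : (0 : ℝ) ∈ Set.Ioo (f y) (f x) := ⟨by simp only [hf]; linarith, by simp only [hf]; linarith⟩
  obtain ⟨z, ⟨hz1, hz2⟩, hz⟩ := intermediate_value_Ioo' hxy.le hc h0
  exact ⟨z, hz1, hz2, by simpa [hf, sub_eq_zero] using hz⟩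

/-- The interval from `x` to `y` lies in the abscissa range of both segments. If the order of the
lines changed there, they would meet at a point of both open segments. -/
lemma height_lt_height_iff {p q r s : ℝ × ℝ}
    (hd : Disjoint (openSegment ℝ p q) (openSegment ℝ r s)) {x y : ℝ} (hxy : x < y)
    (hx : height r s x ≠ height p q x) (hy : height r s y ≠ height p q y)
    (hpx : p.1 ≤ x) (hrx : r.1 ≤ x) (hyq : y ≤ q.1) (hys : y ≤ s.1) :
    height r s x < height p q x ↔ height r s y < height p q y := by
  have key : ∀ z, x < z → z < y → height p q z = height r s z → False := by
    intro z h1 h2 h3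
    refine Set.disjoint_left.mp hd (height_mem_openSegment (p := p) (q := q) (x := z) ?_) ?_
    · exact mul_neg_of_pos_of_neg (by linarith) (by linarith)
    · rw [h3]
      exact height_mem_openSegment (mul_neg_of_pos_of_neg (by linarith) (by linarith))
  constructor
  · intro h
    by_contra h'
    obtain ⟨z, h1, h2, h3⟩ := exists_height_eq hxy h (lt_of_le_of_ne (not_lt.mp h') hy.symm)
    exact key z h1 h2 h3
  · intro h
    by_contra h'
    obtain ⟨z, h1, h2, h3⟩ := exists_height_eq hxy (lt_of_le_of_ne (not_lt.mp h') hx.symm) h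
    exact key z h1 h2 h3.symm

lemma between_iff {a b x : ℝ} (hab : a < b) : (x - a) * (x - b) < 0 ↔ a < x ∧ x < b := by
  constructor
  · intro h
    constructor <;> by_contra h' <;> nlinarith
  · rintro ⟨h1, h2⟩
    exact mul_neg_of_pos_of_neg (by linarith) (by linarith)

lemma ne_height_of_notMem {p q r : ℝ × ℝ} (h : (r.1 - p.1) * (r.1 - q.1) < 0)
    (hr : r ∉ openSegment ℝ p q) : r.2 ≠ height p q r.1 := by
  intro h'
  apply hr
  have := height_mem_openSegment h
  rwa [← h'] at this

/-- Each end of the common abscissa range is an end point of one segment, and its `below` or `above`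
term asks whether `p q` runs above `r s` there. Disjoint segments give the same answer at both ends,
so the two terms cancel mod 2; the other two terms vanish. -/
lemma crossing_eq_zero_of_lt {p q r s : ℝ × ℝ} (hpq : p.1 < q.1) (hrs : r.1 < s.1)
    (hpr : p.1 ≠ r.1) (hps : p.1 ≠ s.1) (hqr : q.1 ≠ r.1) (hqs : q.1 ≠ s.1)
    (hd : Disjoint (openSegment ℝ p q) (openSegment ℝ r s))
    (hp : p ∉ openSegment ℝ r s) (hq : q ∉ openSegment ℝ r s)
    (hr : r ∉ openSegment ℝ p q) (hs : s ∉ openSegment ℝ p q) :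
    crossing p q r s = 0 := by
  have np := fun h => ne_height_of_notMem (r := p) h hp
  have nq := fun h => ne_height_of_notMem (r := q) h hq
  have nr := fun h => ne_height_of_notMem (r := r) h hr
  have ns := fun h => ne_height_of_notMem (r := s) h hs
  rw [between_iff hrs] at np nq
  rw [between_iff hpq] at nr ns
  have main := fun x y => @height_lt_height_iff p q r s hd x y
  have e1 := height_left p q
  have e2 := height_right hpq.ne
  have e3 := height_left r s
  have e4 := height_right hrs.ne
  simp only [crossing, below, above, between_iff hpq, between_iff hrs]
  -- If the abscissa ranges do not overlap, all four terms vanish.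
  rcases lt_or_gt_of_ne hps with h1 | h1
  swap
  · have a1 : ¬ p.1 < r.1 := by linarith
    have a2 : ¬ p.1 < s.1 := by linarith
    have a3 : ¬ q.1 < s.1 := by linarith
    simp [a1, a2, a3]
  rcases lt_or_gt_of_ne hqr with h2 | h2
  · have a1 : ¬ r.1 < q.1 := by linarith
    have a2 : ¬ s.1 < q.1 := by linarith
    have a3 : ¬ r.1 < p.1 := by linarith
    simp [a1, a2, a3]
  -- The overlap starts at the larger of `p.1`, `r.1` and stops at the smaller of `q.1`, `s.1`.
  rcases lt_or_gt_of_ne hpr with h3 | h3 <;> rcases lt_or_gt_of_ne hqs with h4 | h4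
  · have m := main r.1 q.1 h2 (by rw [e3]; exact nr ⟨h3, h2⟩) (by rw [e2]; exact (nq ⟨h2, h4⟩).symm)
      h3.le le_rfl le_rfl h4.le
    rw [e3, e2] at m
    have a1 : ¬ s.1 < q.1 := by linarith
    have a2 : ¬ r.1 < p.1 := by linarith
    simp only [h3, h2, h1, h4, a1, a2, m, true_and, and_false, false_and, if_false, add_zero, zero_add]
    exact CharTwo.add_self_eq_zero _
  · have m := main r.1 s.1 hrs (by rw [e3]; exact nr ⟨h3, h2⟩) (by rw [e4]; exact ns ⟨h1, h4⟩)
      h3.le le_rfl h4.le le_rfl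
    rw [e3, e4] at m
    have a1 : ¬ q.1 < s.1 := by linarith
    have a2 : ¬ r.1 < p.1 := by linarith
    simp only [h3, h2, h1, h4, a1, a2, m, true_and, and_false, false_and, if_false, add_zero]
    exact CharTwo.add_self_eq_zero _
  · have m := main p.1 q.1 hpq (by rw [e1]; exact (np ⟨h3, h1⟩).symm)
      (by rw [e2]; exact (nq ⟨h2, h4⟩).symm) le_rfl h3.le le_rfl h4.le
    rw [e1, e2] at m
    have a1 : ¬ s.1 < q.1 := by linarith
    have a2 : ¬ p.1 < r.1 := by linarith
    simp only [h3, h2, h1, h4, a1, a2, m, true_and, and_false, false_and, if_false, zero_add]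
    exact CharTwo.add_self_eq_zero _
  · have m := main p.1 s.1 h1 (by rw [e1]; exact (np ⟨h3, h1⟩).symm)
      (by rw [e4]; exact ns ⟨h1, h4⟩) le_rfl h3.le h4.le le_rfl
    rw [e1, e4] at m
    have a1 : ¬ q.1 < s.1 := by linarith
    have a2 : ¬ p.1 < r.1 := by linarith
    simp only [h3, h2, h1, h4, a1, a2, m, true_and, and_false, false_and, if_false, add_zero,
      zero_add]
    exact CharTwo.add_self_eq_zero _

lemma crossing_eq_zero {p q r s : ℝ × ℝ} (hpq : p.1 ≠ q.1) (hrs : r.1 ≠ s.1)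
    (hpr : p.1 ≠ r.1) (hps : p.1 ≠ s.1) (hqr : q.1 ≠ r.1) (hqs : q.1 ≠ s.1)
    (hd : Disjoint (openSegment ℝ p q) (openSegment ℝ r s))
    (hp : p ∉ openSegment ℝ r s) (hq : q ∉ openSegment ℝ r s)
    (hr : r ∉ openSegment ℝ p q) (hs : s ∉ openSegment ℝ p q) :
    crossing p q r s = 0 := by
  wlog h1 : p.1 < q.1 generalizing p q
  · rw [crossing_swap_left hpq]
    rw [openSegment_symm] at hd hr hs
    exact this hpq.symm hqr hqs hpr hps hd hq hp hr hs (lt_of_le_of_ne (not_lt.mp h1) hpq.symm)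
  wlog h2 : r.1 < s.1 generalizing r s
  · rw [crossing_swap_right hrs]
    rw [openSegment_symm ℝ r s] at hd hp hq
    exact this hrs.symm hps hpr hqs hqr hd hp hq hs hr (lt_of_le_of_ne (not_lt.mp h2) hrs.symm)
  exact crossing_eq_zero_of_lt h1 h2 hpr hps hqr hqs hd hp hq hr hs

lemma contact_self (a : ℝ × ℝ) : contact a a = 0 := by
  simp [contact, mul_comm]

lemma crossing_self {p q : ℝ × ℝ} : crossing p q p q = 0 := by
  simp [crossing, below, above]

/-- The common end is never strictly between abscissae, so it contributes nothing. If both segments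
leave `p` to the same side, the end of the horizontally shorter one decides, and it records whether
`p q` leaves above `p s`. -/
lemma crossing_of_common {p q s : ℝ × ℝ} (hpq : p.1 ≠ q.1) (hps : p.1 ≠ s.1)
    (hqs : q.1 ≠ s.1) : crossing p q p s = contact (q - p) (s - p) := by
  have hq : q.1 - p.1 ≠ 0 := sub_ne_zero.mpr hpq.symm
  have hs : s.1 - p.1 ≠ 0 := sub_ne_zero.mpr hps.symm
  simp only [crossing, below, above, contact, sub_self, zero_mul, lt_irrefl, false_and, if_false,
    zero_add, Prod.fst_sub, Prod.snd_sub, height]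
  obtain ⟨a, ha⟩ : ∃ a, a = q.1 - p.1 := ⟨_, rfl⟩
  obtain ⟨b, hb⟩ : ∃ b, b = s.1 - p.1 := ⟨_, rfl⟩
  obtain ⟨c, hc⟩ : ∃ c, c = q.2 - p.2 := ⟨_, rfl⟩
  obtain ⟨d, hd⟩ : ∃ d, d = s.2 - p.2 := ⟨_, rfl⟩
  have hab : a ≠ b := by
    intro h; apply hqs; linarith
  have f1 : s.1 - q.1 = b - a := by linarith
  have f2 : q.1 - s.1 = a - b := by linarith
  have f3 : s.2 < p.2 + b * (c / a) ↔ d < b * (c / a) := by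
    rw [hd]; constructor <;> intro h <;> linarith
  have f4 : p.2 + a * (d / b) < q.2 ↔ a * (d / b) < c := by
    rw [hc]; constructor <;> intro h <;> linarith
  simp only [← ha, ← hb, ← hc, ← hd, f1, f2, f3, f4]
  rw [← ha] at hq
  rw [← hb] at hs
  clear f1 f2 f3 f4
  have g1 : b * (c / a) = b * c / a := by ring
  have g2 : a * (d / b) = a * d / b := by ring
  simp only [g1, g2]
  -- On the same side both tests become the same inequality `0 < a * (b * c - d * a)`, and the
  -- comparison of `a` with `b` selects the one that applies.
  rcases lt_or_gt_of_ne hq with h1 | h1 <;> rcases lt_or_gt_of_ne hs with h2 | h2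
  · have k0 : 0 < a * b := mul_pos_of_neg_of_neg h1 h2
    have k1 : d < b * c / a ↔ 0 < a * (b * c - d * a) := by
      rw [lt_div_iff_of_neg h1]
      constructor <;> intro h <;> [skip; by_contra h'] <;> nlinarith
    have k2 : a * d / b < c ↔ 0 < a * (b * c - d * a) := by
      rw [div_lt_iff_of_neg h2]
      constructor <;> intro h <;> [skip; by_contra h'] <;> nlinarith
    simp only [k1, k2]
    rcases lt_or_gt_of_ne hab with h3 | h3
    · have l1 : b * (b - a) < 0 := by nlinarith
      have l2 : ¬ a * (a - b) < 0 := by nlinarith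
      simp [k0, l1, l2]
    · have l1 : ¬ b * (b - a) < 0 := by nlinarith
      have l2 : a * (a - b) < 0 := by nlinarith
      simp [k0, l1, l2]
  · have k0 : ¬ 0 < a * b := by nlinarith
    have l1 : ¬ b * (b - a) < 0 := by nlinarith
    have l2 : ¬ a * (a - b) < 0 := by nlinarith
    simp [k0, l1, l2]
  · have k0 : ¬ 0 < a * b := by nlinarith
    have l1 : ¬ b * (b - a) < 0 := by nlinarith
    have l2 : ¬ a * (a - b) < 0 := by nlinarith
    simp [k0, l1, l2]
  · have k0 : 0 < a * b := mul_pos h1 h2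
    have k1 : d < b * c / a ↔ 0 < a * (b * c - d * a) := by
      rw [lt_div_iff₀ h1]
      constructor <;> intro h <;> [skip; by_contra h'] <;> nlinarith
    have k2 : a * d / b < c ↔ 0 < a * (b * c - d * a) := by
      rw [div_lt_iff₀ h2]
      constructor <;> intro h <;> [skip; by_contra h'] <;> nlinarith
    simp only [k1, k2]
    rcases lt_or_gt_of_ne hab with h3 | h3
    · have l1 : ¬ b * (b - a) < 0 := by nlinarith
      have l2 : a * (a - b) < 0 := by nlinarith
      simp [k0, l1, l2]
    · have l1 : b * (b - a) < 0 := by nlinarith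
      have l2 : ¬ a * (a - b) < 0 := by nlinarith
      simp [k0, l1, l2]

/-- Two directions on the same side of the vertical line contribute once in total. -/
lemma contact_add_contact {a b : ℝ × ℝ} (ha : a.1 ≠ 0) (hb : b.1 ≠ 0)
    (h : 0 < a.1 * b.1 → b.1 * a.2 - b.2 * a.1 ≠ 0) :
    contact a b + contact b a = 1 + rightward a + rightward b := by
  have e : a.1 * b.2 - a.2 * b.1 = -(b.1 * a.2 - b.2 * a.1) := by ring
  simp only [contact, rightward, e]
  generalize b.1 * a.2 - b.2 * a.1 = w at *
  rcases lt_or_gt_of_ne ha with h1 | h1 <;> rcases lt_or_gt_of_ne hb with h2 | h2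
  · have k0 : 0 < a.1 * b.1 := mul_pos_of_neg_of_neg h1 h2
    rcases lt_or_gt_of_ne (h k0) with h3 | h3
    · simp [k0, mul_comm b.1 a.1, h1.not_gt, h2.not_gt, mul_pos_of_neg_of_neg h1 h3,
        (mul_pos_of_neg_of_neg h2 h3).le]
    · simp [k0, mul_comm b.1 a.1, h1.not_gt, h2.not_gt, (mul_neg_of_neg_of_pos h1 h3).le,
        mul_neg_of_neg_of_pos h2 h3]
  · have k0 : ¬ 0 < a.1 * b.1 := by nlinarith
    simp [k0, mul_comm b.1 a.1, h1.not_gt, h2]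
    decide
  · have k0 : ¬ 0 < a.1 * b.1 := by nlinarith
    simp [k0, mul_comm b.1 a.1, h1, h2.not_gt]
    decide
  · have k0 : 0 < a.1 * b.1 := mul_pos h1 h2
    rcases lt_or_gt_of_ne (h k0) with h3 | h3
    · simp [k0, mul_comm b.1 a.1, h1, h2, h3.not_gt, mul_neg_of_pos_of_neg h2 h3]
      decide
    · simp [k0, mul_comm b.1 a.1, h1, h2, h3, (mul_pos h2 h3).not_gt]
      decide

lemma rightward_add_rightward_neg {a : ℝ × ℝ} (ha : a.1 ≠ 0) :
    rightward a + rightward (-a) = 1 := by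
  rcases lt_or_gt_of_ne ha with h | h <;> simp [rightward, h, h.not_gt]

end PlaneParity

/-! ### Contacts of two mod 2 cycles in a straight-line network -/

namespace PlaneParity

open Classical in
/-- The crossing number of two segments, written as a sum over their common end points. -/
lemma crossing_eq_sum_contact {p q r s : ℝ × ℝ} (hpq : p.1 ≠ q.1) (hrs : r.1 ≠ s.1)
    (hpr : p.1 = r.1 → p = r) (hps : p.1 = s.1 → p = s)
    (hqr : q.1 = r.1 → q = r) (hqs : q.1 = s.1 → q = s)
    (h : p ≠ r → p ≠ s → q ≠ r → q ≠ s → crossing p q r s = 0) :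
    crossing p q r s =
      ((if p = r then contact (q - p) (s - r) else 0) +
        (if p = s then contact (q - p) (r - s) else 0)) +
      ((if q = r then contact (p - q) (s - r) else 0) +
        (if q = s then contact (p - q) (r - s) else 0)) := by
  have npq : p ≠ q := fun e => hpq (by rw [e])
  have nrs : r ≠ s := fun e => hrs (by rw [e])
  by_cases e1 : p = r
  · subst e1
    by_cases e2 : q = s
    · subst e2
      simp [crossing_self, contact_self, npq, npq.symm]
    · rw [crossing_of_common hpq hrs fun e => e2 (hqs e)]
      simp [e2, npq.symm, nrs]
  by_cases e2 : p = s
  · subst e2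
    rw [crossing_swap_right hrs]
    by_cases e3 : q = r
    · subst e3
      simp [crossing_self, contact_self, npq, npq.symm]
    · rw [crossing_of_common hpq hrs.symm fun e => e3 (hqr e)]
      simp [e3, npq.symm, e1]
  by_cases e3 : q = r
  · subst e3
    rw [crossing_swap_left hpq, crossing_of_common hpq.symm hrs fun e => e2 (hps e)]
    simp [npq, e2, nrs]
  by_cases e4 : q = s
  · subst e4
    rw [crossing_swap_left hpq, crossing_swap_right hrs,
      crossing_of_common hpq.symm hrs.symm fun e => e1 (hpr e)]
    simp [npq, e1, nrs.symm]
  simp [h e1 e2 e3 e4, e1, e2, e3, e4]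

section Network

variable {S N : Type*} [Fintype S] [Fintype N] [DecidableEq N]

/-- A mod 2 cycle has zero boundary, so it pairs to zero with the coboundary of any function on the
nodes: regroup the sum by node. -/
lemma sum_flags_eq_zero (en : S × Bool → N) (β : S → ZMod 2)
    (hβ : ∀ n, ∑ f : S × Bool, (if en f = n then β f.1 else 0) = 0) (g : N → ZMod 2) :
    ∑ s, β s * (g (en (s, false)) + g (en (s, true))) = 0 := by
  have h : ∀ f : S × Bool, β f.1 * g (en f) = ∑ n, (if en f = n then β f.1 else 0) * g n := by
    intro f
    simp [ite_mul]
  calc ∑ s, β s * (g (en (s, false)) + g (en (s, true)))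
      = ∑ f : S × Bool, β f.1 * g (en f) := by
        rw [Fintype.sum_prod_type]
        refine Finset.sum_congr rfl fun s _ => ?_
        simp only [Fintype.sum_bool]
        ring
    _ = ∑ n, (∑ f : S × Bool, (if en f = n then β f.1 else 0)) * g n := by
        simp_rw [h, Finset.sum_mul]
        exact Finset.sum_comm
    _ = 0 := by simp [hβ]

/-- The direction in which an end of a segment leaves its node. -/
def flagDir (en : S × Bool → N) (P : N → ℝ × ℝ) (f : S × Bool) : ℝ × ℝ :=
  P (en (f.1, !f.2)) - P (en f)

/-- In a plane straight-line network, the contacts between two families of segments that are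
even at every node sum to zero. -/
theorem sum_contact_eq_zero (en : S × Bool → N) (P : N → ℝ × ℝ)
    (hP : Function.Injective fun n => (P n).1) (hne : ∀ s, en (s, false) ≠ en (s, true))
    (hd : Pairwise fun s t => Disjoint
      (openSegment ℝ (P (en (s, false))) (P (en (s, true))))
      (openSegment ℝ (P (en (t, false))) (P (en (t, true)))))
    (hm : ∀ n s, P n ∉ openSegment ℝ (P (en (s, false))) (P (en (s, true))))
    (α β : S → ZMod 2)
    (hα : ∀ n, ∑ f : S × Bool, (if en f = n then α f.1 else 0) = 0)
    (hβ : ∀ n, ∑ f : S × Bool, (if en f = n then β f.1 else 0) = 0) :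
    ∑ f : S × Bool, ∑ f' : S × Bool,
      (if en f = en f' then α f.1 * β f'.1 * contact (flagDir en P f) (flagDir en P f') else 0)
      = 0 := by
  classical
  have hP' : Function.Injective P := fun a b h => hP (by simp [h])
  have hx : ∀ {a b}, a ≠ b → (P a).1 ≠ (P b).1 := fun h e => h (hP e)
  have pair : ∀ s t, crossing (P (en (s, false))) (P (en (s, true))) (P (en (t, false)))
      (P (en (t, true))) = ∑ i, ∑ j, if en (s, i) = en (t, j) then
        contact (flagDir en P (s, i)) (flagDir en P (t, j)) else 0 := by
    intro s t
    rw [crossing_eq_sum_contact (hx (hne s)) (hx (hne t)) (fun e => congrArg P (hP e))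
      (fun e => congrArg P (hP e)) (fun e => congrArg P (hP e)) (fun e => congrArg P (hP e))]
    · simp only [Fintype.sum_bool, hP'.eq_iff, flagDir, Bool.not_true, Bool.not_false]
      ring
    · intro h1 h2 h3 h4
      have hst : s ≠ t := by
        rintro rfl
        exact h1 rfl
      exact crossing_eq_zero (hx (hne s)) (hx (hne t)) (fun e => h1 (congrArg P (hP e)))
        (fun e => h2 (congrArg P (hP e))) (fun e => h3 (congrArg P (hP e)))
        (fun e => h4 (congrArg P (hP e))) (hd hst) (hm _ _) (hm _ _) (hm _ _) (hm _ _)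
  have total : ∑ s, ∑ t, α s * β t * crossing (P (en (s, false))) (P (en (s, true)))
      (P (en (t, false))) (P (en (t, true))) = 0 := by
    -- With `s` fixed, `below` is a function of the node at the end of `t`, so the cycle `β`
    -- annihilates it; `z2` exchanges the roles.
    have z1 : ∑ s, ∑ t, α s * β t * (below (P (en (s, false))) (P (en (s, true)))
        (P (en (t, false))) + below (P (en (s, false))) (P (en (s, true))) (P (en (t, true))))
        = 0 := by
      refine Finset.sum_eq_zero fun s _ => ?_
      simp_rw [mul_assoc]
      rw [← Finset.mul_sum, sum_flags_eq_zero en β hβ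
        (fun n => below (P (en (s, false))) (P (en (s, true))) (P n)), mul_zero]
    have z2 : ∑ s, ∑ t, α s * β t * (above (P (en (t, false))) (P (en (t, true)))
        (P (en (s, false))) + above (P (en (t, false))) (P (en (t, true))) (P (en (s, true))))
        = 0 := by
      rw [Finset.sum_comm]
      refine Finset.sum_eq_zero fun t _ => ?_
      simp_rw [mul_comm (α _) (β t), mul_assoc]
      rw [← Finset.mul_sum, sum_flags_eq_zero en α hα
        (fun n => above (P (en (t, false))) (P (en (t, true))) (P n)), mul_zero]
    simp only [crossing]
    simp_rw [mul_add (α _ * β _) (_ + _) (_ + _), Finset.sum_add_distrib]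
    rw [z1, z2, add_zero]
  refine Eq.trans ?_ total
  rw [Fintype.sum_prod_type]
  refine Finset.sum_congr rfl fun s _ => ?_
  simp_rw [Fintype.sum_prod_type]
  rw [Finset.sum_comm]
  refine Finset.sum_congr rfl fun t _ => ?_
  rw [pair, Finset.mul_sum]
  refine Finset.sum_congr rfl fun i _ => ?_
  rw [Finset.mul_sum]
  refine Finset.sum_congr rfl fun j _ => ?_
  rw [mul_ite, mul_zero]

end Network

end PlaneParity

/-! ### Cyclic order of three directions, and shears -/

namespace PlaneParity

open Multigraph

/-- The cross product of two plane vectors. -/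
def cross (a b : ℂ) : ℝ := a.re * b.im - a.im * b.re

lemma cross_swap (a b : ℂ) : cross a b = -cross b a := by
  unfold cross; ring

lemma cross_polar (r s α β : ℝ) :
    cross (r * Complex.exp (α * Complex.I)) (s * Complex.exp (β * Complex.I)) =
      r * s * Real.sin (β - α) := by
  simp [cross, Complex.exp_ofReal_mul_I_re, Complex.exp_ofReal_mul_I_im, Real.sin_sub]
  ring

/-- At least two of three cyclically consecutive directions turn left. -/
def MostlyLeft (a b c : ℂ) : Prop :=
  0 < cross a b ∧ 0 < cross b c ∨ 0 < cross b c ∧ 0 < cross c a ∨ 0 < cross c a ∧ 0 < cross a b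

lemma counterclockwise_rotate {a b c : ℂ} (h : Counterclockwise a b c) :
    Counterclockwise b c a := by
  obtain ⟨r, s, t, α, β, γ, hr, hs, ht, rfl, rfl, rfl, h1, h2, h3⟩ := h
  refine ⟨s, t, r, β, γ, α + 2 * Real.pi, hs, ht, hr, rfl, rfl, ?_, h2, h3, by linarith⟩
  push_cast
  rw [add_mul, Complex.exp_add, Complex.exp_two_pi_mul_I, mul_one]

/-- The three successive angles are positive with sum 2π, so at most one of them reaches π; the
other two have positive sine. -/
lemma Counterclockwise.mostlyLeft {a b c : ℂ} (h : Counterclockwise a b c) :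
    MostlyLeft a b c := by
  obtain ⟨r, s, t, α, β, γ, hr, hs, ht, rfl, rfl, rfl, h1, h2, h3⟩ := h
  have e : Real.sin (α - γ) = Real.sin (α + 2 * Real.pi - γ) := by
    rw [show α + 2 * Real.pi - γ = α - γ + 2 * Real.pi by ring, Real.sin_add_two_pi]
  simp only [MostlyLeft, cross_polar, e]
  have k1 : β - α < Real.pi → 0 < r * s * Real.sin (β - α) := fun h =>
    mul_pos (mul_pos hr hs) (Real.sin_pos_of_pos_of_lt_pi (by linarith) h)
  have k2 : γ - β < Real.pi → 0 < s * t * Real.sin (γ - β) := fun h =>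
    mul_pos (mul_pos hs ht) (Real.sin_pos_of_pos_of_lt_pi (by linarith) h)
  have k3 : α + 2 * Real.pi - γ < Real.pi → 0 < t * r * Real.sin (α + 2 * Real.pi - γ) := fun h =>
    mul_pos (mul_pos ht hr) (Real.sin_pos_of_pos_of_lt_pi (by linarith) h)
  by_cases c1 : β - α < Real.pi
  · by_cases c2 : γ - β < Real.pi
    · exact Or.inl ⟨k1 c1, k2 c2⟩
    · exact Or.inr (Or.inr ⟨k3 (by linarith), k1 c1⟩)
  · exact Or.inr (Or.inl ⟨k2 (by linarith), k3 (by linarith)⟩)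

/-- Reversal changes the sign of all three cross products, and two of three cannot be positive while
two of three are negative. -/
lemma not_counterclockwise_reverse {a b c : ℂ} (h : Counterclockwise a b c) :
    ¬ Counterclockwise c b a := by
  intro h'
  have m := Counterclockwise.mostlyLeft h
  have m' := Counterclockwise.mostlyLeft h'
  rw [MostlyLeft, cross_swap c b, cross_swap b a, cross_swap a c] at m'
  rcases m with m | m | m <;> rcases m' with m' | m' | m' <;> linarith [m.1, m.2, m'.1, m'.2]

lemma counterclockwise_of_arg_lt {a b c : ℂ} (ha : a ≠ 0) (hb : b ≠ 0) (hc : c ≠ 0)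
    (h1 : a.arg < b.arg) (h2 : b.arg < c.arg) : Counterclockwise a b c := by
  refine ⟨‖a‖, ‖b‖, ‖c‖, a.arg, b.arg, c.arg, norm_pos_iff.mpr ha, norm_pos_iff.mpr hb,
    norm_pos_iff.mpr hc, (Complex.norm_mul_exp_arg_mul_I a).symm,
    (Complex.norm_mul_exp_arg_mul_I b).symm, (Complex.norm_mul_exp_arg_mul_I c).symm, h1, h2, ?_⟩
  linarith [Complex.neg_pi_lt_arg a, Complex.arg_le_pi c]

lemma arg_ne_of_not_parallel {a b : ℂ} (ha : a ≠ 0) (hb : b ≠ 0)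
    (h : ∀ k : ℝ, 0 < k → a ≠ k * b) : a.arg ≠ b.arg := by
  intro e
  refine h (‖a‖ / ‖b‖) (div_pos (norm_pos_iff.mpr ha) (norm_pos_iff.mpr hb)) ?_
  have hb' : (‖b‖ : ℂ) ≠ 0 := by simpa using hb
  calc a = ‖a‖ * Complex.exp (b.arg * Complex.I) := by rw [← e, Complex.norm_mul_exp_arg_mul_I]
    _ = ‖a‖ / ‖b‖ * (‖b‖ * Complex.exp (b.arg * Complex.I)) := by field_simp
    _ = ↑(‖a‖ / ‖b‖) * b := by rw [Complex.norm_mul_exp_arg_mul_I]; push_cast; rfl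

lemma counterclockwise_or_reverse {a b c : ℂ} (ha : a ≠ 0) (hb : b ≠ 0) (hc : c ≠ 0)
    (hab : ∀ k : ℝ, 0 < k → a ≠ k * b) (hbc : ∀ k : ℝ, 0 < k → b ≠ k * c)
    (hac : ∀ k : ℝ, 0 < k → a ≠ k * c) :
    Counterclockwise a b c ∨ Counterclockwise c b a := by
  have n1 := arg_ne_of_not_parallel ha hb hab
  have n2 := arg_ne_of_not_parallel hb hc hbc
  have n3 := arg_ne_of_not_parallel ha hc hac
  rcases lt_or_gt_of_ne n1 with h1 | h1 <;> rcases lt_or_gt_of_ne n2 with h2 | h2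
  · exact Or.inl (counterclockwise_of_arg_lt ha hb hc h1 h2)
  · rcases lt_or_gt_of_ne n3 with h3 | h3
    · exact Or.inr (counterclockwise_rotate (counterclockwise_of_arg_lt ha hc hb h3 h2))
    · exact Or.inl (counterclockwise_rotate (counterclockwise_of_arg_lt hc ha hb h3 h1))
  · rcases lt_or_gt_of_ne n3 with h3 | h3
    · exact Or.inr (counterclockwise_rotate (counterclockwise_rotate
        (counterclockwise_of_arg_lt hb ha hc h1 h3)))
    · exact Or.inl (counterclockwise_rotate (counterclockwise_rotate
        (counterclockwise_of_arg_lt hb hc ha h2 h3)))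
  · exact Or.inr (counterclockwise_of_arg_lt hc hb ha h2 h1)

/-- The shear of the plane with parameter `t`, in real coordinates. -/
def shear (t : ℝ) : ℂ →ₗ[ℝ] ℝ × ℝ where
  toFun z := (z.re + t * z.im, z.im)
  map_add' z w := by ext <;> simp; ring
  map_smul' c z := by ext <;> simp; ring

lemma shear_injective (t : ℝ) : Function.Injective (shear t) := by
  intro z w h
  simp only [shear, LinearMap.coe_mk, AddHom.coe_mk, Prod.mk.injEq] at h
  obtain ⟨h1, h2⟩ := h
  rw [h2] at h1
  exact Complex.ext (by linarith) h2

/-- The determinant of two vectors given by real coordinates. -/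
def det (a b : ℝ × ℝ) : ℝ := a.1 * b.2 - a.2 * b.1

/-- A shear has determinant 1. This is why orientation is passed on through cross products rather
than angles, which a shear distorts. -/
lemma cross_eq_det_shear (t : ℝ) (a b : ℂ) : cross a b = det (shear t a) (shear t b) := by
  simp [shear, cross, det]; ring

/-- For almost all shears, the images of finitely many points have distinct abscissae. -/
lemma exists_shear_injective {N : Type*} [Finite N] {P : N → ℂ} (hP : Function.Injective P) :
    ∃ t, Function.Injective fun n => (shear t (P n)).1 := by
  have hfin : (Set.range fun x : N × N =>
      -(((P x.1).re - (P x.2).re) / ((P x.1).im - (P x.2).im))).Finite := Set.finite_range _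
  obtain ⟨t, ht⟩ := hfin.infinite_compl.nonempty
  refine ⟨t, fun m n h => hP ?_⟩
  simp only [shear, LinearMap.coe_mk, AddHom.coe_mk] at h
  by_cases him : (P m).im = (P n).im
  · rw [him] at h
    exact Complex.ext (by linarith) him
  · exfalso
    refine ht ⟨(m, n), ?_⟩
    have := sub_ne_zero.mpr him
    simp only
    field_simp
    linarith

/-- A direction that is not vertical is determined by its side, its width and its slope away from
the vertical axis. -/
lemma exists_normal_form {a : ℝ × ℝ} (ha : a.1 ≠ 0) :
    ∃ k m : ℝ, 0 < k ∧ (a = (k, k * m) ∨ a = (-k, k * m)) := by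
  rcases lt_or_gt_of_ne ha with h | h
  · refine ⟨-a.1, a.2 / -a.1, by linarith, Or.inr ?_⟩
    ext
    · simp
    · simp; field_simp
  · refine ⟨a.1, a.2 / a.1, h, Or.inl ?_⟩
    ext
    · simp
    · simp; field_simp

lemma contact_right_right {k k' : ℝ} (hk : 0 < k) (hk' : 0 < k') (m m' : ℝ) [Decidable (m' < m)] :
    contact (k, k * m) (k', k' * m') = if m' < m then 1 else 0 := by
  have e : k * (k' * (k * m) - k' * m' * k) = k * (k * k') * (m - m') := by ring
  have h : 0 < k * (k * k') := by positivity
  simp only [contact, e, mul_pos hk hk', mul_pos_iff_of_pos_left h, sub_pos, true_and]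

lemma contact_left_left {k k' : ℝ} (hk : 0 < k) (hk' : 0 < k') (m m' : ℝ) [Decidable (m' < m)] :
    contact (-k, k * m) (-k', k' * m') = if m' < m then 1 else 0 := by
  have e : -k * (-k' * (k * m) - k' * m' * -k) = k * (k * k') * (m - m') := by ring
  have h : 0 < k * (k * k') := by positivity
  simp only [contact, e, neg_mul_neg, mul_pos hk hk', mul_pos_iff_of_pos_left h, sub_pos, true_and]

lemma contact_right_left {k k' : ℝ} (hk : 0 < k) (hk' : 0 < k') (y y' : ℝ) :
    contact (k, y) (-k', y') = 0 := by
  simp [contact, (mul_pos hk hk').not_gt]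

lemma contact_left_right {k k' : ℝ} (hk : 0 < k) (hk' : 0 < k') (y y' : ℝ) :
    contact (-k, y) (k', y') = 0 := by
  simp [contact, (mul_pos hk hk').not_gt]

lemma det_right_right_pos {k k' : ℝ} (hk : 0 < k) (hk' : 0 < k') (m m' : ℝ) :
    0 < det (k, k * m) (k', k' * m') ↔ m < m' := by
  have e : det (k, k * m) (k', k' * m') = k * k' * (m' - m) := by simp only [det]; ring
  rw [e, mul_pos_iff_of_pos_left (mul_pos hk hk'), sub_pos]

lemma det_right_left_pos {k k' : ℝ} (hk : 0 < k) (hk' : 0 < k') (m m' : ℝ) :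
    0 < det (k, k * m) (-k', k' * m') ↔ 0 < m + m' := by
  have e : det (k, k * m) (-k', k' * m') = k * k' * (m + m') := by simp only [det]; ring
  rw [e, mul_pos_iff_of_pos_left (mul_pos hk hk')]

lemma det_left_right_pos {k k' : ℝ} (hk : 0 < k) (hk' : 0 < k') (m m' : ℝ) :
    0 < det (-k, k * m) (k', k' * m') ↔ m + m' < 0 := by
  have e : det (-k, k * m) (k', k' * m') = k * k' * (-(m + m')) := by simp only [det]; ring
  rw [e, mul_pos_iff_of_pos_left (mul_pos hk hk'), Left.neg_pos_iff]

lemma det_left_left_pos {k k' : ℝ} (hk : 0 < k) (hk' : 0 < k') (m m' : ℝ) :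
    0 < det (-k, k * m) (-k', k' * m') ↔ m' < m := by
  have e : det (-k, k * m) (-k', k' * m') = k * k' * (m - m') := by simp only [det]; ring
  rw [e, mul_pos_iff_of_pos_left (mul_pos hk hk'), sub_pos]

set_option linter.unusedSimpArgs false in
/-- Around a node with three directions in counterclockwise order the contacts cancel. -/
lemma contact_of_mostlyLeft (t : ℝ) {a b c : ℂ} (ha : (shear t a).1 ≠ 0)
    (hb : (shear t b).1 ≠ 0) (hc : (shear t c).1 ≠ 0) (h : MostlyLeft a b c) :
    rightward (shear t a) + (contact (shear t a) (shear t c) + contact (shear t b) (shear t a) +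
      contact (shear t b) (shear t c)) = 0 := by
  simp only [MostlyLeft, cross_eq_det_shear t] at h
  generalize shear t a = a at *
  generalize shear t b = b at *
  generalize shear t c = c at *
  obtain ⟨k, m, hk, ha'⟩ := exists_normal_form ha
  obtain ⟨k', m', hk', hb'⟩ := exists_normal_form hb
  obtain ⟨k'', m'', hk'', hc'⟩ := exists_normal_form hc
  clear ha hb hc
  -- In normal form, determinants and contacts depend only on the sides and on comparisons among
  -- `m`, `m'`, `m''` and their negatives; eight order-theoretic cases remain.
  rcases ha' with rfl | rfl <;> rcases hb' with rfl | rfl <;> rcases hc' with rfl | rfl <;>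
  · simp only [det_right_right_pos, det_left_left_pos, det_right_left_pos, det_left_right_pos, hk,
      hk', hk''] at h
    simp only [contact_right_right, contact_left_left, contact_right_left, contact_left_right, hk,
      hk', hk'', rightward, Left.neg_pos_iff, hk.not_gt, if_true, if_false]
    clear hk hk' hk''
    grind

end PlaneParity

/-! ### Segment ends of a plane drawing -/

namespace Multigraph

namespace Drawing

open PlaneParity

variable {V E : Type*} {G : Multigraph V E}

/-- The node at which an end of a segment sits. -/
def nodeOf (D : G.Drawing) : (Σ e, Fin (D.bends e + 1)) × Bool → V ⊕ (Σ e, Fin (D.bends e))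
  | (s, false) => Fin.cases (motive := fun _ => V ⊕ (Σ e, Fin (D.bends e)))
      (Sum.inl (G.ends s.1 false)) (fun j => Sum.inr ⟨s.1, j⟩) s.2
  | (s, true) => Fin.lastCases (motive := fun _ => V ⊕ (Σ e, Fin (D.bends e)))
      (Sum.inl (G.ends s.1 true)) (fun j => Sum.inr ⟨s.1, j⟩) s.2

/-- The end of a segment that belongs to a half-edge. -/
def firstFlag (D : G.Drawing) : E × Bool → (Σ e, Fin (D.bends e + 1)) × Bool
  | (e, false) => (⟨e, 0⟩, false)
  | (e, true) => (⟨e, Fin.last _⟩, true)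

/-- The two segment ends at a corner. -/
def cornerFlag (D : G.Drawing) (x : Σ e, Fin (D.bends e)) :
    Bool → (Σ e, Fin (D.bends e + 1)) × Bool
  | false => (⟨x.1, x.2.succ⟩, false)
  | true => (⟨x.1, x.2.castSucc⟩, true)

/-- The direction in which a segment end leaves its node. -/
def flagVec (D : G.Drawing) (f : (Σ e, Fin (D.bends e + 1)) × Bool) : ℂ :=
  D.node (D.nodeOf (f.1, !f.2)) - D.node (D.nodeOf f)

variable (D : G.Drawing)

lemma nodeOf_firstFlag (h : E × Bool) : D.nodeOf (D.firstFlag h) = Sum.inl (G.ends h.1 h.2) := by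
  rcases h with ⟨e, _ | _⟩ <;> simp [nodeOf, firstFlag]

lemma nodeOf_cornerFlag (x : Σ e, Fin (D.bends e)) (i : Bool) :
    D.nodeOf (D.cornerFlag x i) = Sum.inr x := by
  rcases i with _ | _ <;> simp [nodeOf, cornerFlag]

lemma firstFlag_fst_fst (h : E × Bool) : (D.firstFlag h).1.1 = h.1 := by
  rcases h with ⟨e, _ | _⟩ <;> rfl

lemma cornerFlag_fst_fst (x : Σ e, Fin (D.bends e)) (i : Bool) :
    (D.cornerFlag x i).1.1 = x.1 := by
  rcases i with _ | _ <;> rfl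

lemma firstFlag_injective : Function.Injective D.firstFlag := by
  rintro ⟨e, _ | _⟩ ⟨e', _ | _⟩ h <;> simp [firstFlag] at h <;> simp [h]

lemma node_nodeOf_false (s : Σ e, Fin (D.bends e + 1)) :
    D.node (D.nodeOf (s, false)) = D.pt s.1 s.2.castSucc := by
  obtain ⟨e, k⟩ := s
  induction k using Fin.cases with
  | zero => simp [nodeOf, node, pt]
  | succ j =>
    simp only [nodeOf, Fin.cases_succ, node, Sum.elim_inr, pt]
    rw [← Fin.succ_castSucc, Fin.cons_succ, Fin.snoc_castSucc]

lemma node_nodeOf_true (s : Σ e, Fin (D.bends e + 1)) :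
    D.node (D.nodeOf (s, true)) = D.pt s.1 s.2.succ := by
  obtain ⟨e, k⟩ := s
  induction k using Fin.lastCases with
  | last => simp [nodeOf, node, pt]
  | cast j => simp [nodeOf, node, pt]

lemma seg_eq (s : Σ e, Fin (D.bends e + 1)) :
    D.seg s = openSegment ℝ (D.node (D.nodeOf (s, false))) (D.node (D.nodeOf (s, true))) := by
  rw [node_nodeOf_false, node_nodeOf_true, seg]

lemma seg_eq' (f : (Σ e, Fin (D.bends e + 1)) × Bool) :
    D.seg f.1 = openSegment ℝ (D.node (D.nodeOf f)) (D.node (D.nodeOf (f.1, !f.2))) := by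
  obtain ⟨s, _ | _⟩ := f
  · exact D.seg_eq s
  · rw [openSegment_symm]
    exact D.seg_eq s

lemma flagVec_firstFlag (h : E × Bool) : D.flagVec (D.firstFlag h) = D.dir h := by
  obtain ⟨e, _ | _⟩ := h
  · simp only [flagVec, firstFlag, Bool.not_false, node_nodeOf_false, node_nodeOf_true, dir,
      Fin.castSucc_zero]
  · simp only [flagVec, firstFlag, Bool.not_true, node_nodeOf_false, node_nodeOf_true, dir,
      Fin.succ_last]

variable {D}

lemma IsPlane.nodeOf_ne (hD : D.IsPlane) (s : Σ e, Fin (D.bends e + 1)) :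
    D.nodeOf (s, false) ≠ D.nodeOf (s, true) := by
  intro h
  apply hD.node_notMem (D.nodeOf (s, false)) s
  -- A degenerate open segment is the singleton of its end, so a node would lie on it.
  rw [seg_eq, ← h, openSegment_same]
  rfl

lemma IsPlane.nodeOf_not_ne (hD : D.IsPlane) (f : (Σ e, Fin (D.bends e + 1)) × Bool) :
    D.nodeOf (f.1, !f.2) ≠ D.nodeOf f := by
  obtain ⟨s, _ | _⟩ := f
  · exact (hD.nodeOf_ne s).symm
  · exact hD.nodeOf_ne s

lemma IsPlane.flagVec_ne_zero (hD : D.IsPlane) (f : (Σ e, Fin (D.bends e + 1)) × Bool) :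
    D.flagVec f ≠ 0 :=
  sub_ne_zero.mpr fun h => hD.nodeOf_not_ne f (hD.node_injective h)

/-- Different segment ends at a node leave it in different directions. -/
lemma IsPlane.flagVec_not_parallel (hD : D.IsPlane) {f f' : (Σ e, Fin (D.bends e + 1)) × Bool}
    (hne : f ≠ f') (hnode : D.nodeOf f = D.nodeOf f') (k : ℝ) (hk : 0 < k) :
    D.flagVec f ≠ k * D.flagVec f' := by
  intro h
  by_cases hs : f.1 = f'.1
  · apply hD.nodeOf_not_ne f
    have h2 : f' = (f.1, !f.2) := by
      refine Prod.ext hs.symm ?_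
      have : f.2 ≠ f'.2 := fun e => hne (Prod.ext hs e)
      revert this
      cases f.2 <;> cases f'.2 <;> simp
    rw [← h2, hnode]
  · have hd := Set.disjoint_left.mp (hD.seg_disjoint hs)
    -- For parallel directions this point has parameter `1 / (1 + k)` on one segment and `k / (1 +
    -- k)` on the other; both are below 1 whatever the size of `k`.
    refine @hd (D.node (D.nodeOf f) + (1 / (1 + k) : ℝ) • D.flagVec f) ?_ ?_
    · rw [seg_eq', openSegment_eq_image']
      refine ⟨1 / (1 + k), ⟨by positivity, ?_⟩, rfl⟩
      rw [div_lt_one (by positivity)]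
      linarith
    · rw [seg_eq', openSegment_eq_image', hnode, h]
      refine ⟨k / (1 + k), ⟨by positivity, ?_⟩, ?_⟩
      · rw [div_lt_one (by positivity)]
        linarith
      · simp only [flagVec, Complex.real_smul]
        push_cast
        ring

lemma IsPlane.dir_ne_zero (hD : D.IsPlane) (h : E × Bool) : D.dir h ≠ 0 := by
  rw [← flagVec_firstFlag]
  exact hD.flagVec_ne_zero _

lemma IsPlane.dir_not_parallel (hD : D.IsPlane) {v : V} {h h' : G.HalfEdgeAt v} (hne : h ≠ h')
    (k : ℝ) (hk : 0 < k) : D.dir h.1 ≠ k * D.dir h'.1 := by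
  rw [← flagVec_firstFlag, ← flagVec_firstFlag]
  refine hD.flagVec_not_parallel (fun e => hne (Subtype.ext (D.firstFlag_injective e))) ?_ k hk
  rw [nodeOf_firstFlag, nodeOf_firstFlag, h.2, h'.2]

/-- The legs at a vertex follow exactly one of the two cyclic orders. -/
lemma IsPlane.isCCW_or_isCW (hD : D.IsPlane) (l : G.LegOrder) (v : V) :
    D.IsCCW l v ∨ D.IsCW l v := by
  have n : ∀ {i j : Fin 3}, i ≠ j → l v i ≠ l v j := fun h e => h ((l v).injective e)
  exact counterclockwise_or_reverse (hD.dir_ne_zero _) (hD.dir_ne_zero _) (hD.dir_ne_zero _)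
    (hD.dir_not_parallel (n (by decide))) (hD.dir_not_parallel (n (by decide)))
    (hD.dir_not_parallel (n (by decide)))

lemma IsPlane.not_isCCW_iff (hD : D.IsPlane) (l : G.LegOrder) (v : V) :
    ¬ D.IsCCW l v ↔ D.IsCW l v :=
  ⟨(hD.isCCW_or_isCW l v).resolve_left, fun h h' => not_counterclockwise_reverse h' h⟩

/-! ### Sums over segment ends -/

section Sums

variable (D) [Fintype E]

/-- Every segment end is either the start of a half-edge or one of the two ends at a unique corner.
-/
lemma sum_flags {M : Type*} [AddCommMonoid M] (g : (Σ e, Fin (D.bends e + 1)) × Bool → M) :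
    ∑ f, g f = ∑ h, g (D.firstFlag h) +
      ∑ x, (g (D.cornerFlag x false) + g (D.cornerFlag x true)) := by
  simp_rw [Fintype.sum_prod_type, Fintype.sum_sigma]
  rw [← Finset.sum_add_distrib]
  refine Finset.sum_congr rfl fun e _ => ?_
  simp only [Fintype.sum_bool, Finset.sum_add_distrib]
  rw [Fin.sum_univ_castSucc, Fin.sum_univ_succ (f := fun k => g (⟨e, k⟩, false))]
  simp only [firstFlag, cornerFlag]
  abel

end Sums

end Drawing

section Legs

variable {V E : Type*} [Fintype E] {G : Multigraph V E} {M : Type*} [AddCommMonoid M]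

lemma sum_halfEdges_at [DecidableEq V] (l : G.LegOrder) (v : V) (F : E × Bool → M) :
    ∑ h, (if G.ends h.1 h.2 = v then F h else 0) = ∑ i, F (l v i).1 := by
  rw [← Finset.sum_filter, Finset.sum_subtype (p := fun h : E × Bool => G.ends h.1 h.2 = v) _
    (by simp) F]
  exact ((l v).sum_comp fun h => F h.1).symm

lemma sum_halfEdges [Fintype V] (l : G.LegOrder) (F : E × Bool → M) :
    ∑ h, F h = ∑ v, ∑ i, F (l v i).1 := by
  classical
  simp_rw [← sum_halfEdges_at l]
  rw [Finset.sum_comm]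
  simp

end Legs

end Multigraph

/-! ### Parity of clockwise vertices for legs ordered by color -/

namespace Multigraph

open PlaneParity

variable {V E : Type*} {G : Multigraph V E}

namespace Drawing

variable {D : G.Drawing}

section Shear

variable {t : ℝ}

lemma flagDir_shear (f : (Σ e, Fin (D.bends e + 1)) × Bool) :
    flagDir D.nodeOf (fun n => shear t (D.node n)) f = shear t (D.flagVec f) := by
  simp [flagDir, flagVec, map_sub]

lemma IsPlane.shear_flagVec_ne_zero (hD : D.IsPlane)
    (ht : Function.Injective fun n => (shear t (D.node n)).1)
    (f : (Σ e, Fin (D.bends e + 1)) × Bool) : (shear t (D.flagVec f)).1 ≠ 0 := by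
  rw [flagVec, map_sub, Prod.fst_sub, sub_ne_zero]
  exact fun h => hD.nodeOf_not_ne f (ht h)

/-- Two segment ends at a node touch iff they leave it to the same side. -/
lemma IsPlane.contact_flags (hD : D.IsPlane)
    (ht : Function.Injective fun n => (shear t (D.node n)).1)
    {f f' : (Σ e, Fin (D.bends e + 1)) × Bool} (hne : f ≠ f') (hnode : D.nodeOf f = D.nodeOf f') :
    contact (shear t (D.flagVec f)) (shear t (D.flagVec f')) +
      contact (shear t (D.flagVec f')) (shear t (D.flagVec f)) =
    1 + rightward (shear t (D.flagVec f)) + rightward (shear t (D.flagVec f')) := by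
  have par := hD.flagVec_not_parallel hne hnode
  have h1 := hD.shear_flagVec_ne_zero ht f
  have h2 := hD.shear_flagVec_ne_zero ht f'
  refine contact_add_contact h1 h2 fun hpos hdet => ?_
  set a := D.flagVec f
  set b := D.flagVec f'
  have hk : 0 < (shear t a).1 / (shear t b).1 := by
    rcases pos_and_pos_or_neg_and_neg_of_mul_pos hpos with h | h
    · exact div_pos h.1 h.2
    · exact div_pos_of_neg_of_neg h.1 h.2
  refine par _ hk (shear_injective t ?_)
  rw [← Complex.real_smul, map_smul]
  ext
  · simp [h2]
  · simp only [Prod.smul_snd, smul_eq_mul]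
    field_simp
    linarith

lemma IsPlane.contact_corner (hD : D.IsPlane)
    (ht : Function.Injective fun n => (shear t (D.node n)).1) (x : Σ e, Fin (D.bends e)) :
    contact (shear t (D.flagVec (D.cornerFlag x false)))
        (shear t (D.flagVec (D.cornerFlag x true))) +
      contact (shear t (D.flagVec (D.cornerFlag x true)))
        (shear t (D.flagVec (D.cornerFlag x false))) =
    1 + rightward (shear t (D.flagVec (D.cornerFlag x false))) +
      rightward (shear t (D.flagVec (D.cornerFlag x true))) :=
  hD.contact_flags ht (by simp [cornerFlag]) (by rw [nodeOf_cornerFlag, nodeOf_cornerFlag])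

lemma IsPlane.contact_halfEdges (hD : D.IsPlane)
    (ht : Function.Injective fun n => (shear t (D.node n)).1) {v : V} {h h' : G.HalfEdgeAt v}
    (hne : h ≠ h') :
    contact (shear t (D.dir h.1)) (shear t (D.dir h'.1)) +
      contact (shear t (D.dir h'.1)) (shear t (D.dir h.1)) =
    1 + rightward (shear t (D.dir h.1)) + rightward (shear t (D.dir h'.1)) := by
  simp only [← flagVec_firstFlag]
  refine hD.contact_flags ht (fun e => hne (Subtype.ext (D.firstFlag_injective e))) ?_
  rw [nodeOf_firstFlag, nodeOf_firstFlag, h.2, h'.2]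

/-- Along an edge the corner contacts telescope. -/
lemma IsPlane.sum_corners (hD : D.IsPlane)
    (ht : Function.Injective fun n => (shear t (D.node n)).1) (e : E) :
    ∑ j : Fin (D.bends e), (1 + rightward (shear t (D.flagVec (D.cornerFlag ⟨e, j⟩ false))) +
      rightward (shear t (D.flagVec (D.cornerFlag ⟨e, j⟩ true)))) =
    1 + rightward (shear t (D.dir (e, false))) + rightward (shear t (D.dir (e, true))) := by
  -- The two ends of a segment point in opposite directions, so exactly one points to the right;
  -- adding over the `bends + 1` segments leaves the two outermost ends after the corners are
  -- removed.
  have seg : ∀ s : Σ e, Fin (D.bends e + 1), rightward (shear t (D.flagVec (s, false))) +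
      rightward (shear t (D.flagVec (s, true))) = 1 := by
    intro s
    have e1 : D.flagVec (s, true) = -D.flagVec (s, false) := by simp [flagVec]
    rw [e1, map_neg]
    exact rightward_add_rightward_neg (hD.shear_flagVec_ne_zero ht _)
  have tot : ∑ k : Fin (D.bends e + 1), (rightward (shear t (D.flagVec (⟨e, k⟩, false))) +
      rightward (shear t (D.flagVec (⟨e, k⟩, true)))) = (D.bends e : ZMod 2) + 1 := by
    simp [seg]
  rw [Finset.sum_add_distrib, Fin.sum_univ_succ, Fin.sum_univ_castSucc (n := D.bends e)] at tot
  rw [← flagVec_firstFlag, ← flagVec_firstFlag]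
  simp only [Finset.sum_add_distrib, firstFlag, cornerFlag]
  simp only [Finset.sum_const, Finset.card_univ, Fintype.card_fin, nsmul_eq_mul, mul_one]
  generalize (D.bends e : ZMod 2) = b at *
  generalize ∑ j : Fin (D.bends e), rightward (shear t (D.flagVec (⟨e, j.succ⟩, false))) = x1 at *
  generalize ∑ j : Fin (D.bends e), rightward (shear t (D.flagVec (⟨e, j.castSucc⟩, true))) = x2 at *
  generalize rightward (shear t (D.flagVec (⟨e, 0⟩, false))) = x3 at *
  generalize rightward (shear t (D.flagVec (⟨e, Fin.last _⟩, true))) = x4 at *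
  clear seg
  revert b x1 x2 x3 x4
  decide

end Shear

section Parity

variable [Fintype E] [DecidableEq V] [DecidableEq E]

/-- The two ends at a corner belong to the same edge and cancel; at a vertex each color occurs once,
leaving the sum of `a`. -/
lemma sum_nodeOf_eq_zero (D : G.Drawing) (l : G.LegOrder) (c : E → Fin 3)
    (hl : ∀ v i, c (l v i).1.1 = i) (a : Fin 3 → ZMod 2) (ha : ∑ i, a i = 0)
    (n : V ⊕ (Σ e, Fin (D.bends e))) :
    ∑ f : (Σ e, Fin (D.bends e + 1)) × Bool, (if D.nodeOf f = n then a (c f.1.1) else 0) = 0 := by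
  rw [sum_flags]
  simp only [nodeOf_firstFlag, nodeOf_cornerFlag, firstFlag_fst_fst, cornerFlag_fst_fst,
    CharTwo.add_self_eq_zero, Finset.sum_const_zero, add_zero]
  rcases n with v | x
  · simp only [Sum.inl.injEq]
    rw [sum_halfEdges_at l v fun h => a (c h.1)]
    simp [hl, ha]
  · simp

/-- The contacts at the vertices balance the number of edges of color `0` and the sides to
which these edges leave. -/
lemma IsPlane.sum_contact_vertices [Fintype V] (hD : D.IsPlane) {t : ℝ}
    (ht : Function.Injective fun n => (shear t (D.node n)).1) (l : G.LegOrder) (c : E → Fin 3)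
    (hl : ∀ v i, c (l v i).1.1 = i) :
    (∑ e, if c e = 0 then (1 : ZMod 2) else 0) +
      ∑ v, (rightward (shear t (D.dir (l v 0).1)) +
        (contact (shear t (D.dir (l v 0).1)) (shear t (D.dir (l v 2).1)) +
         contact (shear t (D.dir (l v 1).1)) (shear t (D.dir (l v 0).1)) +
         contact (shear t (D.dir (l v 1).1)) (shear t (D.dir (l v 2).1)))) = 0 := by
  -- The cycles of colors 0, 1 and of colors 0, 2; their product is the indicator of color 0.
  set a : Fin 3 → ZMod 2 := ![1, 1, 0] with ha
  set b : Fin 3 → ZMod 2 := ![1, 0, 1] with hb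
  have inj := shear_injective t
  have im : ∀ p q, openSegment ℝ (shear t p) (shear t q) = shear t '' openSegment ℝ p q :=
    fun p q => (image_openSegment ℝ (shear t).toAffineMap p q).symm
  have main := sum_contact_eq_zero D.nodeOf (fun n => shear t (D.node n)) ht hD.nodeOf_ne
    (fun s s' hs => by
      simp only [im, Set.disjoint_image_iff inj, ← seg_eq]
      exact hD.seg_disjoint hs)
    (fun n s => by
      rw [im, inj.mem_set_image, ← seg_eq]
      exact hD.node_notMem n s)
    (fun s => a (c s.1)) (fun s => b (c s.1))
    (sum_nodeOf_eq_zero D l c hl a (by decide)) (sum_nodeOf_eq_zero D l c hl b (by decide))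
  simp only [flagDir_shear] at main
  rw [sum_flags] at main
  simp_rw [sum_flags D (fun f' => ite _ _ _)] at main
  -- Vertices and corners are different nodes, so the mixed terms drop out.
  simp only [nodeOf_firstFlag, nodeOf_cornerFlag, firstFlag_fst_fst, cornerFlag_fst_fst,
    flagVec_firstFlag, reduceCtorEq, if_false, add_zero, zero_add, Finset.sum_const_zero,
    Sum.inl.injEq, Sum.inr.injEq, Finset.sum_add_distrib, Finset.sum_ite_eq, Finset.mem_univ,
    if_true] at main
  have vert : (∑ h : E × Bool, ∑ h' : E × Bool, if G.ends h.1 h.2 = G.ends h'.1 h'.2 then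
      a (c h.1) * b (c h'.1) * contact (shear t (D.dir h)) (shear t (D.dir h')) else 0) =
      ∑ v, (contact (shear t (D.dir (l v 0).1)) (shear t (D.dir (l v 2).1)) +
         contact (shear t (D.dir (l v 1).1)) (shear t (D.dir (l v 0).1)) +
         contact (shear t (D.dir (l v 1).1)) (shear t (D.dir (l v 2).1))) := by
    rw [sum_halfEdges l]
    refine Finset.sum_congr rfl fun v _ => ?_
    have inner : ∀ i, (∑ h' : E × Bool, if G.ends (l v i).1.1 (l v i).1.2 = G.ends h'.1 h'.2 then
        a (c (l v i).1.1) * b (c h'.1) *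
          contact (shear t (D.dir (l v i).1)) (shear t (D.dir h')) else 0) =
        ∑ j, a i * b j * contact (shear t (D.dir (l v i).1)) (shear t (D.dir (l v j).1)) := by
      intro i
      simp_rw [(l v i).2, eq_comm (a := v)]
      rw [sum_halfEdges_at l v]
      simp_rw [hl]
    simp_rw [inner, Fin.sum_univ_three, ha, hb]
    simp [contact_self]
    ring
  have corners : (∑ x : (Σ e, Fin (D.bends e)), a (c x.1) * b (c x.1) *
      (contact (shear t (D.flagVec (D.cornerFlag x false)))
        (shear t (D.flagVec (D.cornerFlag x true))) +
      contact (shear t (D.flagVec (D.cornerFlag x true)))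
        (shear t (D.flagVec (D.cornerFlag x false))))) =
      (∑ e, if c e = 0 then (1 : ZMod 2) else 0) + ∑ v, rightward (shear t (D.dir (l v 0).1)) := by
    have hab : ∀ k, a k * b k = if k = 0 then 1 else 0 := by decide
    have hv : ∑ v, rightward (shear t (D.dir (l v 0).1)) =
        ∑ h : E × Bool, (if c h.1 = 0 then rightward (shear t (D.dir h)) else 0) := by
      rw [sum_halfEdges l]
      simp [hl]
    rw [hv, Fintype.sum_prod_type, ← Finset.sum_add_distrib]
    simp_rw [hD.contact_corner ht]
    rw [Fintype.sum_sigma]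
    refine Finset.sum_congr rfl fun e _ => ?_
    dsimp only
    rw [← Finset.mul_sum, hD.sum_corners ht, hab, Fintype.sum_bool]
    split_ifs
    · ring
    · simp
  simp only [contact_self, mul_zero, Finset.sum_const_zero, zero_add, add_zero] at main
  rw [← Finset.sum_add_distrib] at main
  simp_rw [← mul_add] at main
  rw [vert, corners] at main
  rw [Finset.sum_add_distrib, ← add_assoc, add_comm]
  exact main

end Parity

-- At a counterclockwise vertex this is `contact_of_mostlyLeft`. At a clockwise one that identity
-- holds for the legs 0, 2, 1, in which all three contacts are reversed; reversing them back changes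
-- the sum by 1, since every `rightward` term then occurs twice.
open Classical in
lemma IsPlane.contact_vertex (hD : D.IsPlane) {t : ℝ}
    (ht : Function.Injective fun n => (shear t (D.node n)).1) (l : G.LegOrder) (v : V) :
    rightward (shear t (D.dir (l v 0).1)) +
        (contact (shear t (D.dir (l v 0).1)) (shear t (D.dir (l v 2).1)) +
         contact (shear t (D.dir (l v 1).1)) (shear t (D.dir (l v 0).1)) +
         contact (shear t (D.dir (l v 1).1)) (shear t (D.dir (l v 2).1))) =
      if D.IsCW l v then 1 else 0 := by
  have nz : ∀ i, (shear t (D.dir (l v i).1)).1 ≠ 0 := fun i => by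
    rw [← flagVec_firstFlag]
    exact hD.shear_flagVec_ne_zero ht _
  have n : ∀ {i j : Fin 3}, i ≠ j → l v i ≠ l v j := fun h e => h ((l v).injective e)
  by_cases h : D.IsCW l v
  · rw [if_pos h]
    have h' := counterclockwise_rotate (counterclockwise_rotate h)
    have e := contact_of_mostlyLeft t (nz 0) (nz 2) (nz 1) (Counterclockwise.mostlyLeft h')
    have c1 := hD.contact_halfEdges ht (n (show (0 : Fin 3) ≠ 1 by decide))
    have c2 := hD.contact_halfEdges ht (n (show (0 : Fin 3) ≠ 2 by decide))
    have c3 := hD.contact_halfEdges ht (n (show (1 : Fin 3) ≠ 2 by decide))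
    have two : (2 : ZMod 2) = 0 := by decide
    linear_combination c1 + c2 + c3 - e +
      (1 + 2 * rightward (shear t (D.dir (l v 0).1)) + rightward (shear t (D.dir (l v 1).1)) +
        rightward (shear t (D.dir (l v 2).1))) * two
  · rw [if_neg h]
    exact contact_of_mostlyLeft t (nz 0) (nz 1) (nz 2)
      (Counterclockwise.mostlyLeft (not_not.mp fun h' => h ((hD.not_isCCW_iff l v).mp h')))

lemma numCW_eq_sum [Fintype V] (D : G.Drawing) (l : G.LegOrder) [DecidablePred (D.IsCW l)] :
    D.numCW l = ∑ v, if D.IsCW l v then 1 else 0 := by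
  rw [numCW, Set.ncard_eq_toFinset_card', ← Finset.card_filter]
  congr 1
  ext v
  simp

variable [Fintype V] [Fintype E]

/-- Every vertex has exactly one half-edge of color 0, and every edge of color 0 has two. -/
lemma card_eq_two_mul_card_color (l : G.LegOrder) (c : E → Fin 3)
    (hl : ∀ v i, c (l v i).1.1 = i) :
    Fintype.card V = 2 * ∑ e, if c e = 0 then 1 else 0 := by
  have h := sum_halfEdges l fun h => if c h.1 = 0 then 1 else 0
  rw [Fintype.sum_prod_type] at h
  simp only [hl, Fintype.sum_bool, Finset.sum_ite_eq', Finset.mem_univ, if_true,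
    Finset.sum_const, Finset.card_univ, smul_eq_mul, mul_one] at h
  rw [← h, Finset.mul_sum]
  exact Finset.sum_congr rfl fun e _ => (two_mul _).symm

/-- If the legs are ordered by color, the number of clockwise vertices has the parity of half
the number of vertices. -/
theorem IsPlane.numCW_color_order (hD : D.IsPlane) (l : G.LegOrder) (c : E → Fin 3)
    (hl : ∀ v i, c (l v i).1.1 = i) : Even (Fintype.card V / 2 + D.numCW l) := by
  classical
  obtain ⟨t, ht⟩ := exists_shear_injective hD.node_injective
  have h := hD.sum_contact_vertices ht l c hl
  simp_rw [hD.contact_vertex ht] at h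
  rw [card_eq_two_mul_card_color l c hl, Nat.mul_div_cancel_left _ two_pos, numCW_eq_sum,
    ← ZMod.natCast_eq_zero_iff_even]
  push_cast
  exact h

end Drawing

end Multigraph

/-! ### From the parity to the signs and the contraction -/

namespace Multigraph

open PlaneParity

variable {V E : Type*} {G : Multigraph V E}

lemma IsCubic.nonempty_legOrder (hG : G.IsCubic) : Nonempty G.LegOrder :=
  ⟨fun v =>
    have : Finite (G.HalfEdgeAt v) := Nat.finite_of_card_ne_zero (by rw [hG v]; decide)
    (Finite.equivFinOfCardEq (hG v)).symm⟩

/-- Counting half-edges in two ways gives 2|E| = 3|V|. -/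
lemma even_card_of_legOrder [Fintype V] [Fintype E] (l : G.LegOrder) :
    Even (Fintype.card V) := by
  have h := sum_halfEdges l fun _ => 1
  simp only [Finset.sum_const, Finset.card_univ, Fintype.card_prod, Fintype.card_bool,
    Fintype.card_fin, smul_eq_mul, mul_one] at h
  rw [Nat.even_iff]
  omega

/-- Reverses the order of the legs at the vertices of `A`. -/
noncomputable def LegOrder.reverseOn (l : G.LegOrder) (A : Set V) : G.LegOrder :=
  open Classical in fun v => if v ∈ A then (Equiv.swap 0 2).trans (l v) else l v

namespace Drawing

variable {D : G.Drawing}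

lemma isCW_reverseOn_of_mem {l : G.LegOrder} {A : Set V} {v : V} (h : v ∈ A) :
    D.IsCW (l.reverseOn A) v ↔ D.IsCCW l v := by
  simp [IsCW, IsCCW, LegOrder.reverseOn, h, Equiv.swap_apply_of_ne_of_ne]

lemma isCW_reverseOn_of_notMem {l : G.LegOrder} {A : Set V} {v : V} (h : v ∉ A) :
    D.IsCW (l.reverseOn A) v ↔ D.IsCW l v := by
  simp [IsCW, LegOrder.reverseOn, h]

/-- Every set of vertices is the set of clockwise vertices of some leg order. -/
lemma IsPlane.exists_isCW_iff (hD : D.IsPlane) (l : G.LegOrder) (A : Set V) :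
    ∃ l' : G.LegOrder, ∀ v, D.IsCW l' v ↔ v ∈ A := by
  refine ⟨l.reverseOn {v | ¬ (D.IsCW l v ↔ v ∈ A)}, fun v => ?_⟩
  by_cases h : D.IsCW l v ↔ v ∈ A
  · rw [isCW_reverseOn_of_notMem (by simpa using h), h]
  · rw [isCW_reverseOn_of_mem h]
    have := hD.not_isCCW_iff l v
    tauto

open Classical in
/-- The sign of a reordering of the legs is the product of the orientations. -/
lemma IsPlane.epsilon_eq (hD : D.IsPlane) (l l' : G.LegOrder) (v : V) {i j k : Fin 3}
    (h0 : l v 0 = l' v i) (h1 : l v 1 = l' v j) (h2 : l v 2 = l' v k) :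
    epsilon i j k =
      (-1) ^ (if D.IsCW l v then 1 else 0) * (-1) ^ (if D.IsCW l' v then 1 else 0) := by
  have hij : i ≠ j := by
    rintro rfl
    exact absurd ((l v).injective (h0.trans h1.symm)) (by decide)
  have hjk : j ≠ k := by
    rintro rfl
    exact absurd ((l v).injective (h1.trans h2.symm)) (by decide)
  have hik : i ≠ k := by
    rintro rfl
    exact absurd ((l v).injective (h0.trans h2.symm)) (by decide)
  have rot : ∀ {a b c : ℂ}, Counterclockwise b c a ↔ Counterclockwise a b c :=
    ⟨fun h => counterclockwise_rotate (counterclockwise_rotate h), counterclockwise_rotate⟩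
  have cw : D.IsCW l v ↔
      Counterclockwise (D.dir (l' v k).1) (D.dir (l' v j).1) (D.dir (l' v i).1) := by
    rw [IsCW, h0, h1, h2]
  have cw' := (hD.not_isCCW_iff l' v).symm
  simp only [cw, cw']
  simp only [IsCW, IsCCW] at cw' ⊢
  clear cw h0 h1 h2
  set Q : Fin 3 → Fin 3 → Fin 3 → Prop := fun x y z =>
    Counterclockwise (D.dir (l' v x).1) (D.dir (l' v y).1) (D.dir (l' v z).1)
  have r : ∀ x y z, Q y z x ↔ Q x y z := fun x y z => rot
  change Q 2 1 0 ↔ ¬ Q 0 1 2 at cw'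
  change epsilon i j k = (-1) ^ (if Q k j i then 1 else 0) * (-1) ^ (if ¬ Q 0 1 2 then 1 else 0)
  clear_value Q
  -- Cyclic invariance reduces every orientation to `Q 0 1 2` or its reverse `Q 2 1 0`, which are
  -- complementary.
  have r1 := r 0 1 2
  have r2 := r 1 2 0
  have r3 := r 2 1 0
  have r4 := r 1 0 2
  have perms : ∀ x y z : Fin 3, x ≠ y → y ≠ z → x ≠ z →
      (x = 0 ∧ y = 1 ∧ z = 2) ∨ (x = 1 ∧ y = 2 ∧ z = 0) ∨ (x = 2 ∧ y = 0 ∧ z = 1) ∨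
      (x = 0 ∧ y = 2 ∧ z = 1) ∨ (x = 2 ∧ y = 1 ∧ z = 0) ∨ (x = 1 ∧ y = 0 ∧ z = 2) := by decide
  rcases perms i j k hij hjk hik with ⟨rfl, rfl, rfl⟩ | ⟨rfl, rfl, rfl⟩ | ⟨rfl, rfl, rfl⟩ |
    ⟨rfl, rfl, rfl⟩ | ⟨rfl, rfl, rfl⟩ | ⟨rfl, rfl, rfl⟩ <;>
  by_cases hq : Q 0 1 2 <;> simp [epsilon, r1, r2, r3, r4, cw', hq]

lemma IsPlane.weight_of_isProper [Fintype V] [Fintype E] (hD : D.IsPlane) (l : G.LegOrder)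
    {c : E → Fin 3} (hc : G.IsProper c) :
    weight l (fun h => c h.1) = (-1) ^ (Fintype.card V / 2 + D.numCW l) := by
  classical
  have bij : ∀ v, Function.Bijective fun i => c (l v i).1.1 := fun v =>
    Finite.injective_iff_bijective.mp fun i j h => by
      by_contra hij
      exact hc v _ _ (fun e => hij ((l v).injective e)) h
  -- The leg order by color: leg `i` of `l'` is the half-edge of color `i`, so the colors seen by
  -- `l` at a vertex are the permutation from `l'` to `l`.
  let l' : G.LegOrder := fun v => (Equiv.ofBijective _ (bij v)).symm.trans (l v)
  have hl' : ∀ v i, l v i = l' v (c (l v i).1.1) := fun v i => by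
    simp only [l', Equiv.trans_apply]
    congr 1
    exact ((Equiv.ofBijective _ (bij v)).symm_apply_apply i).symm
  have color : ∀ v i, c (l' v i).1.1 = i := fun v i =>
    (Equiv.ofBijective _ (bij v)).apply_symm_apply i
  have par := hD.numCW_color_order l' c color
  have w : weight l (fun h => c h.1) = (-1) ^ D.numCW l * (-1) ^ D.numCW l' := by
    rw [numCW_eq_sum, numCW_eq_sum, ← Finset.prod_pow_eq_pow_sum, ← Finset.prod_pow_eq_pow_sum,
      ← Finset.prod_mul_distrib]
    simp only [weight, wire, if_true, Finset.prod_const_one, mul_one]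
    exact Finset.prod_congr rfl fun v _ => hD.epsilon_eq l l' v (hl' v 0) (hl' v 1) (hl' v 2)
  rw [w, ← pow_add]
  exact neg_one_pow_congr (by rw [Nat.even_add, Nat.even_add, Nat.even_add.mp par]; tauto)

end Drawing

lemma exists_isProper_of_weight_ne_zero [Fintype V] [Fintype E] {l : G.LegOrder}
    {i : E × Bool → Fin 3} (h : weight l i ≠ 0) :
    ∃ c, G.IsProper c ∧ (fun h : E × Bool => c h.1) = i := by
  obtain ⟨h1, h2⟩ := mul_ne_zero_iff.mp h
  rw [Finset.prod_ne_zero_iff] at h1 h2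
  have wires : ∀ e, i (e, false) = i (e, true) := fun e => by
    by_contra hne
    exact h2 e (Finset.mem_univ e) (if_neg hne)
  have hi : ∀ h : E × Bool, i (h.1, false) = i h := by
    rintro ⟨e, _ | _⟩
    · rfl
    · exact wires e
  refine ⟨fun e => i (e, false), fun v a b hab => ?_, funext hi⟩
  obtain ⟨x, rfl⟩ := (l v).surjective a
  obtain ⟨y, rfl⟩ := (l v).surjective b
  have hxy : x ≠ y := fun e => hab (by rw [e])
  have eps : ∀ p q r, epsilon p q r ≠ 0 → p ≠ q ∧ q ≠ r ∧ p ≠ r := by decide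
  obtain ⟨e1, e2, e3⟩ := eps _ _ _ (h1 v (Finset.mem_univ v))
  change i _ ≠ i _
  rw [hi, hi]
  fin_cases x <;> fin_cases y <;>
    first | exact absurd rfl hxy | assumption | (apply Ne.symm; assumption)

lemma Drawing.IsPlane.contraction_eq [Fintype V] [Fintype E] [DecidableEq E] {D : G.Drawing}
    (hD : D.IsPlane) (l : G.LegOrder) :
    contraction l = (-1) ^ (Fintype.card V / 2 + D.numCW l) * (G.numColorings : ℤ) := by
  classical
  have h := Fintype.sum_of_injective
    (fun c : {c : E → Fin 3 // G.IsProper c} => fun h : E × Bool => c.1 h.1)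
    (fun c c' h => Subtype.ext (funext fun e => congrFun h (e, false)))
    (fun _ => (-1) ^ (Fintype.card V / 2 + D.numCW l)) (weight l)
    (fun i hi => by
      by_contra hw
      obtain ⟨c, hc, rfl⟩ := exists_isProper_of_weight_ne_zero hw
      exact hi ⟨⟨c, hc⟩, rfl⟩)
    (fun c => (hD.weight_of_isProper l c.2).symm)
  rw [contraction, ← h, numColorings, Nat.card_eq_fintype_card]
  simp [mul_comm]

end Multigraph

theorem theorem2 {V E : Type*} [Fintype V] [Fintype E] [DecidableEq E]
    (G : Multigraph V E) (hG : G.IsCubic) (D : G.Drawing) (hD : D.IsPlane) :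
    -- the exponents `card V / 2` below are exact
    Even (Fintype.card V) ∧
    -- the legs can be put in the planar cyclic order at all vertices simultaneously
    (∃ l : G.LegOrder, ∀ v, D.IsCCW l v) ∧
    (∀ l : G.LegOrder,
      -- any order of the three legs at a vertex is one of the two planar cyclic orders
      (∀ v, Xor (D.IsCCW l v) (D.IsCW l v)) ∧
      -- all proper colorings contribute the same sign
      (∀ c : E → Fin 3, G.IsProper c →
        Multigraph.weight l (fun h => c h.1) = (-1) ^ (Fintype.card V / 2 + D.numCW l)) ∧
      Multigraph.contraction l =
        (-1) ^ (Fintype.card V / 2 + D.numCW l) * (G.numColorings : ℤ) ∧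
      (Even (Fintype.card V / 2 + D.numCW l) →
        Multigraph.contraction l = (G.numColorings : ℤ))) ∧
    -- there are leg orders for which the contraction is the number of colorings itself
    (∃ l : G.LegOrder, Even (Fintype.card V / 2 + D.numCW l) ∧
      Multigraph.contraction l = (G.numColorings : ℤ)) := by
  obtain ⟨l₀⟩ := hG.nonempty_legOrder
  have hcard := Multigraph.even_card_of_legOrder l₀
  have heven : ∀ l : G.LegOrder, Even (Fintype.card V / 2 + D.numCW l) →
      Multigraph.contraction l = (G.numColorings : ℤ) := fun l h => by
    rw [hD.contraction_eq l, h.neg_one_pow, one_mul]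
  refine ⟨hcard, ?_, fun l => ⟨fun v => ?_, fun c hc => hD.weight_of_isProper l hc,
    hD.contraction_eq l, heven l⟩, ?_⟩
  · obtain ⟨l, hl⟩ := hD.exists_isCW_iff l₀ ∅
    exact ⟨l, fun v => (hD.isCCW_or_isCW l v).resolve_right fun h => (hl v).mp h⟩
  · have := hD.not_isCCW_iff l v
    unfold Xor
    tauto
  · suffices ∃ A : Set V, Even (Fintype.card V / 2 + A.ncard) by
      obtain ⟨A, hA⟩ := this
      obtain ⟨l, hl⟩ := hD.exists_isCW_iff l₀ A
      have h : D.numCW l = A.ncard := by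
        rw [Multigraph.Drawing.numCW]
        congr 1
        exact Set.ext hl
      rw [← h] at hA
      exact ⟨l, hA, heven l hA⟩
    -- Only the parity of `A` matters, so the empty set or one vertex suffices; in the odd case a
    -- vertex exists.
    by_cases h : Even (Fintype.card V / 2)
    · exact ⟨∅, by simpa using h⟩
    · have : Nonempty V := by
        by_contra hV
        rw [not_nonempty_iff] at hV
        simp at h
      obtain ⟨v⟩ := this
      refine ⟨{v}, ?_⟩
      rw [Set.ncard_singleton]
      exact (Nat.not_even_iff_odd.mp h).add_odd odd_one
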